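/- **Conventions.** Let $\mathbb{T}=\mathbb{R}\cup\{-\infty\}$ with $a\oplus b=\max(a,b)$, $a\odot b=a+b$. Let $G(r\times s)$ be the set of $r\times s$ matrices over $\mathbb{T}$ with at most one finite entry in each row, and $G(r)$ the set of $r\times r$ matrices with exactly one finite entry in each row and column. For $A\in G(r\times s)$ let $f_A:\mathbb{R}^s\to\mathbb{R}^r$ be $x\mapsto A\odot x$ with every entry $-\infty$ replaced by $0$. The tropical rank $\operatorname{troprank}(A)$ is the integer $k$ such that all $(k+1)\times(k+1)$ minors (tropical determinants $\bigoplus_{\sigma}\bigodot_i a_{i,\sigma(i)}$ of square submatrices) of $A$ are $-\infty$ and some $k\times k$ minor is not $-\infty$. Tropical cycles are abstract tropical cycles: equivalence classes, up to common refinement, of weighted, pure-dimensional, finite rational polyhedral complexes $X$ in which the open star $S_\sigma$ of every polyhedron $\sigma$ is identified by a homeomorphism $\Phi_\sigma:S_\sigma\to|F_\sigma|$ with (the support of) an open balanced weighted fan $F_\sigma$, compatibly with weights and integer affine structures. All representatives below are reduced (all weights of maximal polyhedra are non-zero). A morphism $C\to D$ of tropical cycles is a continuous map $f:|C|\to|D|$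 such that for some reduced representatives $X$ of $C$ and $Y$ of $D$ every $\sigma\in X$ is mapped into some $\tau\in Y$ such that $f(S_\sigma)\subseteq S_\tau$ and $\Psi_\tau\circ f\circ\Phi_\sigma^{-1}:|F_\sigma|\to|F_\tau|$ (with $\Psi_\tau$ the structure maps of $Y$) is integer affine linear and induces a morphism of fans. A continuous function on an open set $U\subseteq|C|$ is regular invertible if, for some representative, it is locally integer affine linear in the charts of the polyhedra and in the charts $\Phi_\sigma$. A tropical vector bundle of rank $r$ over $X$ is a tropical cycle $F$ with a morphism $\pi:F\to X$ and a finite open cover $\{U_i\}$ of $|X|$ with homeomorphisms $\Phi_i:\pi^{-1}(U_i)\to U_i\times\mathbb{R}^r$ over $U_i$, whose $\mathbb{R}^r$-components are regular invertible, such that $\Phi_j\circ\Phi_i^{-1}$ is $(x,a)\mapsto(x,f_{M_{ij}(x)}(a))$ with $M_{ij}:U_i\cap U_j\to G(r)$ having entries that are regular invertible or constantly $-\infty$, and such that for suitable representatives the polyhedra of $F$ are the preimages $\pi^{-1}(\tau)$ of the polyhedra $\tau$ of $X$, with the same weights on maximal ones. A local trivialization of $F$ is an open $U\subseteq|X|$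 with a homeomorphism $\pi^{-1}(U)\to U\times\mathbb{R}^r$ over $U$ that has these properties relative to the given ones. A morphism $\phi:\mathcal{E}\to\mathcal{F}$ of tropical vector bundles of ranks $e$ and $f$ over $X$ is a morphism of tropical cycles over $X$ for which there are a finite open cover $\{U_i\}$ of $|X|$ by common domains of local trivializations $\Phi_i^{\mathcal{E}}$ of $\mathcal{E}$ and $\Phi_i^{\mathcal{F}}$ of $\mathcal{F}$, and maps $A_i:U_i\to G(f\times e)$ whose entries are regular invertible or constantly $-\infty$, such that $\Phi_i^{\mathcal{F}}\circ\phi\circ(\Phi_i^{\mathcal{E}})^{-1}$ is $(x,a)\mapsto(x,f_{A_i(x)}(a))$. For $p\in|X|$, the stalk map $\phi_p:\mathbb{T}^e\to\mathbb{T}^f$ is given by the matrix $A(p)\in G(f\times e)$, for any local trivializations of $\mathcal{E}$ and $\mathcal{F}$ over a common open set $U\ni p$ in which $\phi$ is represented in this way by a map $A:U\to G(f\times e)$. **Statement.** Let $\phi:\mathcal{E}\to\mathcal{F}$ be a morphism of tropical vector bundles of ranks $e$ and $f$ over a tropical cycle $X$. Then: 1. for every $p\in|X|$ the number $\operatorname{troprank}(\phi_p)$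 is well defined: the tropical rank of $A(p)$ exists, is unique, and does not depend on the choice of local trivializations; 2. the function $\operatorname{rank}(\phi):|X|\to\mathbb{Z}$, $p\mapsto\operatorname{troprank}(\phi_p)$, is locally constant; 3. $\operatorname{rank}(\phi)$ takes values in $\{0,1,\dots,ef\}$, and $\operatorname{rank}(\phi):X\to Z$ is a morphism of tropical cycles, where $Z=\{0,1,\dots,ef\}$ is the $0$-dimensional tropical cycle with the discrete topology, whose polyhedra are the points, all of weight $1$. -/

import Mathlib

open Set Topology

/-! ## Tropical linear algebra -/

/-- The tropical semiring `𝕋 = ℝ ∪ {-∞}`, with tropical sum `⊔` (the maximum), tropical product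
`+`, and `-∞ = ⊥`. -/
abbrev TropNum : Type := WithBot ℝ

/-- Tropical matrices. -/
abbrev TropMat (r s : ℕ) : Type := Matrix (Fin r) (Fin s) TropNum

/-- `A ∈ G(r × s)`: every row of `A` has at most one finite entry. -/
def IsRowMonomial {r s : ℕ} (A : TropMat r s) : Prop :=
  ∀ i j j', A i j ≠ ⊥ → A i j' ≠ ⊥ → j = j'

/-- `A ∈ G(r)`: every row and every column of `A` has exactly one finite entry. -/
def IsMonomial {r : ℕ} (A : TropMat r r) : Prop :=
  (∀ i, ∃! j, A i j ≠ ⊥) ∧ ∀ j, ∃! i, A i j ≠ ⊥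

/-- The tropical determinant. -/
noncomputable def tropDet {k : ℕ} (A : TropMat k k) : TropNum :=
  Finset.univ.sup fun σ : Equiv.Perm (Fin k) => ∑ i, A i (σ i)

/-- `troprank A = k`: all `(k+1) × (k+1)` minors vanish (are `-∞`) and some `k × k` minor does
not. -/
def IsTropRank {r s : ℕ} (A : TropMat r s) (k : ℕ) : Prop :=
  (∀ (I : Fin (k + 1) ↪o Fin r) (J : Fin (k + 1) ↪o Fin s), tropDet (A.submatrix I J) = ⊥) ∧
    ∃ (I : Fin k ↪o Fin r) (J : Fin k ↪o Fin s), tropDet (A.submatrix I J) ≠ ⊥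

/-- The map `f_A : ℝ^s → ℝ^r`: the tropical product `A ⊙ x`, in which the entries `-∞` are
replaced by `0`. -/
noncomputable def tropMap {r s : ℕ} (A : TropMat r s) (x : Fin s → ℝ) : Fin r → ℝ :=
  fun i => (Finset.univ.sup fun j => A i j + (x j : TropNum)).unbotD 0

/-! ## Rational polyhedra and tropical fans -/

/-- The linear map `ℝ^m → ℝ^n` of an integer matrix. -/
noncomputable def intLinear {m n : ℕ} (A : Matrix (Fin n) (Fin m) ℤ) (x : Fin m → ℝ) :
    Fin n → ℝ :=
  (A.map fun a : ℤ => (a : ℝ)).mulVec x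

/-- Integer affine linear maps: integer linear part, real translation part. -/
def IsIntAffine {m n : ℕ} (g : (Fin m → ℝ) → (Fin n → ℝ)) : Prop :=
  ∃ (A : Matrix (Fin n) (Fin m) ℤ) (b : Fin n → ℝ), ∀ x, g x = intLinear A x + b

/-- Integer affine linear functions `ℝ^m → ℝ`. -/
def IsIntAffineFun {m : ℕ} (g : (Fin m → ℝ) → ℝ) : Prop :=
  ∃ (a : Fin m → ℤ) (b : ℝ), ∀ x, g x = ∑ i, (a i : ℝ) * x i + b

/-- Rational polyhedra: finite intersections of half spaces with integer normal vectors. -/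
def IsRationalPolyhedron {N : ℕ} (P : Set (Fin N → ℝ)) : Prop :=
  ∃ (k : ℕ) (a : Fin k → Fin N → ℤ) (c : Fin k → ℝ),
    P = {x | ∀ i, c i ≤ ∑ j, (a i j : ℝ) * x j}

/-- Rational polyhedral cones. -/
def IsRationalCone {N : ℕ} (C : Set (Fin N → ℝ)) : Prop :=
  ∃ (k : ℕ) (a : Fin k → Fin N → ℤ), C = {x | ∀ i, 0 ≤ ∑ j, (a i j : ℝ) * x j}

/-- `D` is a face of the cone `C` (possibly `C` itself). -/
def IsConeFace {N : ℕ} (D C : Set (Fin N → ℝ)) : Prop :=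
  ∃ l : Fin N → ℝ, (∀ x ∈ C, 0 ≤ ∑ j, l j * x j) ∧ D = {x ∈ C | ∑ j, l j * x j = 0}

/-- The dimension of a cone. -/
noncomputable def coneDim {N : ℕ} (C : Set (Fin N → ℝ)) : ℕ :=
  Module.finrank ℝ (Submodule.span ℝ C)

/-- The integer vector `v`, as a vector of `ℝ^N`. -/
def intVec {N : ℕ} (v : Fin N → ℤ) : Fin N → ℝ := fun i => (v i : ℝ)

/-- `v` is an integer vector representing the primitive normal vector `v_{σ/τ}`: its class
generates `(V_σ ∩ ℤ^N) / (V_τ ∩ ℤ^N)`, and it points towards `σ`. Here `τ` is a face of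
codimension one of the cone `σ`. -/
def IsPrimitiveNormal {N : ℕ} (τ σ : Set (Fin N → ℝ)) (v : Fin N → ℤ) : Prop :=
  intVec v ∈ Submodule.span ℝ σ ∧
  (∀ w : Fin N → ℤ, intVec w ∈ Submodule.span ℝ σ →
    ∃ k : ℤ, intVec (w - k • v) ∈ Submodule.span ℝ τ) ∧
  ∃ u ∈ Submodule.span ℝ τ, intVec v + u ∈ σ

open Classical in
/-- A tropical fan of pure dimension `n` in `ℝ^N`: a rational polyhedral fan with integer weights
on its `n`-dimensional cones, satisfying the balancing condition in codimension one. (The values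
of `weight` on other sets are irrelevant.) -/
structure TropicalFan (N n : ℕ) where
  cones : Finset (Set (Fin N → ℝ))
  isRationalCone : ∀ σ ∈ cones, IsRationalCone σ
  face_mem : ∀ σ ∈ cones, ∀ τ, IsConeFace τ σ → τ ∈ cones
  inter_face : ∀ σ ∈ cones, ∀ τ ∈ cones, IsConeFace (σ ∩ τ) σ
  pure : ∀ τ ∈ cones, ∃ σ ∈ cones, τ ⊆ σ ∧ coneDim σ = n
  weight : Set (Fin N → ℝ) → ℤ
  balanced : ∀ τ ∈ cones, coneDim τ + 1 = n →
    ∃ v : Set (Fin N → ℝ) → Fin N → ℤ,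
      (∀ σ ∈ cones, τ ⊆ σ → coneDim σ = n → IsPrimitiveNormal τ σ (v σ)) ∧
      intVec (∑ σ ∈ cones with τ ⊆ σ ∧ coneDim σ = n, weight σ • v σ) ∈ Submodule.span ℝ τ

/-- The support `|F|` of a fan. -/
def TropicalFan.support {N n : ℕ} (F : TropicalFan N n) : Set (Fin N → ℝ) :=
  ⋃ σ ∈ F.cones, σ

/-! ## Abstract tropical cycles -/

/-- An abstract (rational, finite) polyhedral complex of pure dimension `n` with support `T`:
a finite set of closed subsets of `T`, each embedded onto a full-dimensional rational polyhedron.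
(The values of `dim` and `chart σ` are only relevant for faces `σ`, and on `σ`.) -/
structure PolyComplex (T : Type*) [TopologicalSpace T] (n : ℕ) where
  faces : Set (Set T)
  finite_faces : faces.Finite
  nonempty_of_mem : ∀ σ ∈ faces, σ.Nonempty
  isClosed_of_mem : ∀ σ ∈ faces, IsClosed σ
  dim : Set T → ℕ
  chart : (σ : Set T) → T → (Fin (dim σ) → ℝ)
  inter_mem : ∀ σ ∈ faces, ∀ τ ∈ faces, (σ ∩ τ).Nonempty → σ ∩ τ ∈ faces
  chart_isEmbedding : ∀ σ ∈ faces, IsEmbedding (σ.domRestrict (chart σ))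
  chart_isPolyhedron : ∀ σ ∈ faces, IsRationalPolyhedron (chart σ '' σ)
  chart_full : ∀ σ ∈ faces, affineSpan ℝ (chart σ '' σ) = ⊤
  chart_compat : ∀ σ ∈ faces, ∀ τ ∈ faces,
    ∃ g : (Fin (dim τ) → ℝ) → (Fin (dim σ) → ℝ), IsIntAffine g ∧
      ∀ x ∈ σ ∩ τ, chart σ x = g (chart τ x)
  partition : ∀ x : T, ∃! σ, σ ∈ faces ∧ x ∈ σ ∧ chart σ x ∈ interior (chart σ '' σ)
  pure : ∀ σ ∈ faces, ∃ τ ∈ faces, σ ⊆ τ ∧ dim τ = n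

namespace PolyComplex

variable {T : Type*} [TopologicalSpace T] {n : ℕ}

/-- The relative interior of a polyhedron of the complex. -/
def relInt (X : PolyComplex T n) (σ : Set T) : Set T :=
  {x ∈ σ | X.chart σ x ∈ interior (X.chart σ '' σ)}

/-- The open star `S_σ`: the union of the relative interiors of the polyhedra containing `σ`. -/
def star (X : PolyComplex T n) (σ : Set T) : Set T :=
  ⋃ τ ∈ {τ | τ ∈ X.faces ∧ σ ⊆ τ}, X.relInt τ

end PolyComplex

/-- A reduced tropical polyhedral complex of dimension `n` with support `T`: a polyhedral complex
with non-zero integer weights on its `n`-dimensional polyhedra and, for each polyhedron `σ`, a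
homeomorphism `fanChart σ` from the open star of `σ` onto the support `|fan σ| ∩ nbhd σ` of an open
tropical fan, identifying polyhedra with cones, respecting weights and integer structures, and
with integer affine linear transition maps. -/
structure TropicalComplex (T : Type*) [TopologicalSpace T] (n : ℕ) extends PolyComplex T n where
  weight : Set T → ℤ
  weight_ne_zero : ∀ σ ∈ faces, dim σ = n → weight σ ≠ 0
  amb : Set T → ℕ
  fan : (σ : Set T) → TropicalFan (amb σ) n
  nbhd : (σ : Set T) → Set (Fin (amb σ) → ℝ)
  isOpen_nbhd : ∀ σ ∈ faces, IsOpen (nbhd σ)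
  zero_mem_nbhd : ∀ σ ∈ faces, 0 ∈ nbhd σ
  fanChart : (σ : Set T) → T → (Fin (amb σ) → ℝ)
  fanChart_isEmbedding : ∀ σ ∈ faces,
    IsEmbedding ((toPolyComplex.star σ).domRestrict (fanChart σ))
  fanChart_image : ∀ σ ∈ faces,
    fanChart σ '' toPolyComplex.star σ = (fan σ).support ∩ nbhd σ
  fanChart_face : ∀ σ ∈ faces, ∀ τ ∈ faces, σ ⊆ τ →
    ∃ c ∈ (fan σ).cones, fanChart σ '' (τ ∩ toPolyComplex.star σ) = c ∩ nbhd σ ∧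
      (dim τ = n → weight τ = (fan σ).weight c)
  fanChart_of_chart : ∀ σ ∈ faces, ∀ τ ∈ faces, σ ⊆ τ →
    ∃ g : (Fin (dim τ) → ℝ) → (Fin (amb σ) → ℝ), IsIntAffine g ∧
      ∀ x ∈ τ ∩ toPolyComplex.star σ, fanChart σ x = g (chart τ x)
  chart_of_fanChart : ∀ σ ∈ faces, ∀ τ ∈ faces, σ ⊆ τ →
    ∃ g : (Fin (amb σ) → ℝ) → (Fin (dim τ) → ℝ), IsIntAffine g ∧
      ∀ x ∈ τ ∩ toPolyComplex.star σ, chart τ x = g (fanChart σ x)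
  fanChart_transition : ∀ σ ∈ faces, ∀ τ ∈ faces,
    ∃ g : (Fin (amb σ) → ℝ) → (Fin (amb τ) → ℝ), IsIntAffine g ∧
      ∀ x ∈ toPolyComplex.star σ ∩ toPolyComplex.star τ, fanChart τ x = g (fanChart σ x)

namespace TropicalComplex

variable {T : Type*} [TopologicalSpace T] {n : ℕ}

/-- `τ` is the inclusion-minimal polyhedron of `Y` containing `σ`. -/
def IsMinimalFace (Y : TropicalComplex T n) (σ τ : Set T) : Prop :=
  τ ∈ Y.faces ∧ σ ⊆ τ ∧ ∀ τ' ∈ Y.faces, σ ⊆ τ' → τ ⊆ τ'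

/-- `X` is a refinement of `Y`, with the same integer structure, weights and tropical
structure. -/
structure Refines (X Y : TropicalComplex T n) : Prop where
  subset_face : ∀ σ ∈ X.faces, ∃ τ ∈ Y.faces, σ ⊆ τ
  chart_compat : ∀ σ ∈ X.faces, ∀ τ ∈ Y.faces, σ ⊆ τ →
    (∃ g : (Fin (X.dim σ) → ℝ) → (Fin (Y.dim τ) → ℝ), IsIntAffine g ∧
      ∀ x ∈ σ, Y.chart τ x = g (X.chart σ x)) ∧
    ∃ g : (Fin (Y.dim τ) → ℝ) → (Fin (X.dim σ) → ℝ), IsIntAffine g ∧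
      ∀ x ∈ σ, X.chart σ x = g (Y.chart τ x)
  weight_eq : ∀ σ ∈ X.faces, X.dim σ = n → ∀ τ, Y.IsMinimalFace σ τ → X.weight σ = Y.weight τ
  fanChart_compat : ∀ σ ∈ X.faces, ∀ τ, Y.IsMinimalFace σ τ →
    (∃ g : (Fin (X.amb σ) → ℝ) → (Fin (Y.amb τ) → ℝ), IsIntAffine g ∧
      ∀ x ∈ X.star σ ∩ Y.star τ, Y.fanChart τ x = g (X.fanChart σ x)) ∧
    ∃ g : (Fin (Y.amb τ) → ℝ) → (Fin (X.amb σ) → ℝ), IsIntAffine g ∧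
      ∀ x ∈ X.star σ ∩ Y.star τ, X.fanChart σ x = g (Y.fanChart τ x)

/-- Two complexes are equivalent if they have a common refinement. -/
def Equivalent (X Y : TropicalComplex T n) : Prop :=
  ∃ Z : TropicalComplex T n, Z.Refines X ∧ Z.Refines Y

end TropicalComplex

/-- Tropical `n`-cycles with support `|C| = T`: equivalence classes of reduced tropical polyhedral
complexes. -/
def TropicalCycle (T : Type*) [TopologicalSpace T] (n : ℕ) : Type _ :=
  Quot (TropicalComplex.Equivalent (T := T) (n := n))

namespace TropicalCycle

variable {T : Type*} [TopologicalSpace T] {n : ℕ} {S : Type*} [TopologicalSpace S] {m : ℕ}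

/-- `X` is a (reduced) representative of the cycle `C`. -/
def IsRep (X : TropicalComplex T n) (C : TropicalCycle T n) : Prop :=
  Quot.mk TropicalComplex.Equivalent X = C

/-- Morphisms of tropical cycles: continuous maps `|C| → |D|` such that, for suitable reduced
representatives, every polyhedron `σ` is mapped into a polyhedron `τ` and
`Ψ_τ ∘ f ∘ Φ_σ⁻¹ : |F_σ| → |F_τ|` induces a morphism of fans, i.e. it is the restriction of
an integer affine linear map whose linear part maps the fan of `σ` to the fan of `τ`. -/
def IsMorphism (C : TropicalCycle T n) (D : TropicalCycle S m) (f : T → S) : Prop :=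
  Continuous f ∧ ∃ (X : TropicalComplex T n) (Y : TropicalComplex S m), IsRep X C ∧ IsRep Y D ∧
    ∀ σ ∈ X.faces, ∃ τ ∈ Y.faces, f '' σ ⊆ τ ∧ f '' X.star σ ⊆ Y.star τ ∧
      ∃ (A : Matrix (Fin (Y.amb τ)) (Fin (X.amb σ)) ℤ) (b : Fin (Y.amb τ) → ℝ),
        (∀ x ∈ X.star σ, Y.fanChart τ (f x) = intLinear A (X.fanChart σ x) + b) ∧
        ∀ y ∈ (X.fan σ).support, intLinear A y ∈ (Y.fan τ).support

/-- `h` is a regular invertible function on the open set `U ⊆ |C|`: it is continuous on `U` and,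
for some representative of `C`, locally integer affine linear in the charts of the polyhedra (so
that it is a rational function) and in the charts of their open stars. -/
def IsRegularInvertible (C : TropicalCycle T n) (U : Set T) (h : T → ℝ) : Prop :=
  ContinuousOn h U ∧ ∃ X : TropicalComplex T n, IsRep X C ∧ ∀ σ ∈ X.faces,
    (∀ x ∈ U ∩ σ, ∃ V ∈ 𝓝 x, ∃ g : (Fin (X.dim σ) → ℝ) → ℝ, IsIntAffineFun g ∧
      ∀ y ∈ V ∩ (U ∩ σ), h y = g (X.chart σ y)) ∧
    ∀ x ∈ U ∩ X.star σ, ∃ V ∈ 𝓝 x, ∃ g : (Fin (X.amb σ) → ℝ) → ℝ, IsIntAffineFun g ∧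
      ∀ y ∈ V ∩ (U ∩ X.star σ), h y = g (X.fanChart σ y)

/-- On `U`, the entries of the matrix-valued map `M` are regular invertible functions or
constantly `-∞`. -/
def HasRegularEntries (C : TropicalCycle T n) (U : Set T) {r s : ℕ} (M : T → TropMat r s) : Prop :=
  ∀ i j, (∀ x ∈ U, M x i j = ⊥) ∨
    ∃ h : T → ℝ, IsRegularInvertible C U h ∧ ∀ x ∈ U, M x i j = (h x : TropNum)

end TropicalCycle

/-! ## Tropical vector bundles -/

section Bundles

variable {B T T' : Type*} [TopologicalSpace B] [TopologicalSpace T] [TopologicalSpace T'] {n r : ℕ}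

/-- The transition map between the trivializations `t`, `t'` is `(x, a) ↦ (x, f_{M x} a)` for a map
`M : U ∩ U' → G(r)` whose entries are regular invertible or constantly `-∞`. -/
def HasMonomialTransition (X : TropicalCycle B n) {π : T → B}
    (t t' : Bundle.Trivialization (Fin r → ℝ) π) : Prop :=
  ∃ M : B → TropMat r r,
    (∀ x ∈ t.baseSet ∩ t'.baseSet, IsMonomial (M x) ∧
      ∀ a, t' (t.toOpenPartialHomeomorph.symm (x, a)) = (x, tropMap (M x) a)) ∧
    X.HasRegularEntries (t.baseSet ∩ t'.baseSet) M

/-- The components of the trivialization `t` are regular invertible functions on `π⁻¹(U)`. -/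
def HasRegularComponents (F : TropicalCycle T (n + r)) {π : T → B}
    (t : Bundle.Trivialization (Fin r → ℝ) π) : Prop :=
  ∀ j, F.IsRegularInvertible (π ⁻¹' t.baseSet) fun y => (t y).2 j

/-- A tropical vector bundle of rank `r` over the tropical cycle `X`, with total space the
tropical cycle `F`. A `Bundle.Trivialization` is a homeomorphism `π⁻¹(U) ≃ U × ℝ^r` over `U`,
with `U` open. -/
structure TropicalVectorBundle (X : TropicalCycle B n) (r : ℕ) (F : TropicalCycle T (n + r)) where
  proj : T → B
  isMorphism_proj : F.IsMorphism X proj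
  numCharts : ℕ
  triv : Fin numCharts → Bundle.Trivialization (Fin r → ℝ) proj
  cover : ∀ x, ∃ i, x ∈ (triv i).baseSet
  regular_components : ∀ i, HasRegularComponents F (triv i)
  transition : ∀ i j, HasMonomialTransition X (triv i) (triv j)
  faces_weights : ∃ (F₀ : TropicalComplex T (n + r)) (X₀ : TropicalComplex B n),
    F.IsRep F₀ ∧ X.IsRep X₀ ∧ F₀.faces = (fun τ => proj ⁻¹' τ) '' X₀.faces ∧
      ∀ τ ∈ X₀.faces, X₀.dim τ = n → F₀.weight (proj ⁻¹' τ) = X₀.weight τ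

/-- `t` is a local trivialization of the bundle `E`: its components are regular invertible and its
transition maps to and from the given trivializations are as in the definition of a bundle. -/
def TropicalVectorBundle.IsLocalTrivialization {X : TropicalCycle B n}
    {F : TropicalCycle T (n + r)} (E : TropicalVectorBundle X r F)
    (t : Bundle.Trivialization (Fin r → ℝ) E.proj) : Prop :=
  HasRegularComponents F t ∧
    ∀ i, HasMonomialTransition X t (E.triv i) ∧ HasMonomialTransition X (E.triv i) t

variable {e f : ℕ} {X : TropicalCycle B n} {CE : TropicalCycle T (n + e)}
  {CF : TropicalCycle T' (n + f)}

/-- Over the common domain `U` of the local trivializations `tE` and `tF`, the map `φ` of total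
spaces is given by `(x, a) ↦ (x, f_{A x} a)`, where `A : U → G(f × e)` has entries that are
regular invertible or constantly `-∞`. -/
structure IsLocalMatrix (E : TropicalVectorBundle X e CE) (F : TropicalVectorBundle X f CF)
    (φ : T → T') (tE : Bundle.Trivialization (Fin e → ℝ) E.proj)
    (tF : Bundle.Trivialization (Fin f → ℝ) F.proj) (A : B → TropMat f e) : Prop where
  left : E.IsLocalTrivialization tE
  right : F.IsLocalTrivialization tF
  baseSet_eq : tE.baseSet = tF.baseSet
  isRowMonomial : ∀ x ∈ tE.baseSet, IsRowMonomial (A x)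
  map_eq : ∀ x ∈ tE.baseSet, ∀ a,
    tF (φ (tE.toOpenPartialHomeomorph.symm (x, a))) = (x, tropMap (A x) a)
  regular : X.HasRegularEntries tE.baseSet A

/-- A morphism of tropical vector bundles over `X`. -/
structure TropicalBundleMorphism (E : TropicalVectorBundle X e CE)
    (F : TropicalVectorBundle X f CF) where
  toFun : T → T'
  isMorphism : CE.IsMorphism CF toFun
  proj_comp : ∀ y, F.proj (toFun y) = E.proj y
  exists_local : ∃ (s : ℕ) (tE : Fin s → Bundle.Trivialization (Fin e → ℝ) E.proj)
    (tF : Fin s → Bundle.Trivialization (Fin f → ℝ) F.proj) (A : Fin s → B → TropMat f e),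
    (∀ x, ∃ i, x ∈ (tE i).baseSet) ∧ ∀ i, IsLocalMatrix E F toFun (tE i) (tF i) (A i)

/-- `M` is the matrix, in some choice of local trivializations around `p`, of the induced stalk
map `φ_p : 𝕋^e → 𝕋^f`. -/
def TropicalBundleMorphism.IsStalkMatrix {E : TropicalVectorBundle X e CE}
    {F : TropicalVectorBundle X f CF} (φ : TropicalBundleMorphism E F) (p : B)
    (M : TropMat f e) : Prop :=
  ∃ (tE : Bundle.Trivialization (Fin e → ℝ) E.proj)
    (tF : Bundle.Trivialization (Fin f → ℝ) F.proj) (A : B → TropMat f e),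
    p ∈ tE.baseSet ∧ IsLocalMatrix E F φ.toFun tE tF A ∧ A p = M

end Bundles

/-! ## The cycle of finitely many points -/

/-- The fan `{0}` in `ℝ^0`, with weight `1`. -/
noncomputable def pointFan : TropicalFan 0 0 where
  cones := {univ}
  isRationalCone := by
    intro σ hσ
    rw [Finset.mem_singleton] at hσ
    exact ⟨0, fun i => i.elim0, by ext x; simp [hσ]⟩
  face_mem := by
    rintro σ hσ τ ⟨l, -, rfl⟩
    rw [Finset.mem_singleton] at hσ
    simp [hσ]
  inter_face := by
    intro σ hσ τ hτ
    rw [Finset.mem_singleton] at hσ hτ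
    exact ⟨0, by simp, by simp [hσ, hτ]⟩
  pure := by
    intro τ hτ
    exact ⟨τ, hτ, subset_rfl, Module.finrank_zero_of_subsingleton⟩
  weight := fun _ => 1
  balanced := by
    intro τ _ h
    omega

/-- The finite set of points `{0, 1, …, N}`, with the discrete topology, as a polyhedral complex of
dimension `0`: its polyhedra are the points. -/
def pointsPolyComplex (N : ℕ) : PolyComplex (Fin (N + 1)) 0 where
  faces := range fun k => {k}
  finite_faces := finite_range _
  nonempty_of_mem := by rintro _ ⟨k, rfl⟩; exact singleton_nonempty k
  isClosed_of_mem := fun _ _ => isClosed_discrete _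
  dim := fun _ => 0
  chart := fun _ _ => 0
  inter_mem := by
    rintro _ ⟨k, rfl⟩ _ ⟨l, rfl⟩ ⟨x, hx, hx'⟩
    obtain rfl : x = k := hx
    obtain rfl : x = l := hx'
    exact ⟨x, by simp⟩
  chart_isEmbedding := by
    rintro _ ⟨k, rfl⟩
    exact .of_subsingleton _
  chart_isPolyhedron := by
    rintro _ ⟨k, rfl⟩
    exact ⟨0, fun i => i.elim0, fun i => i.elim0, by
      ext x; simpa using (Subsingleton.elim _ _)⟩
  chart_full := by
    rintro _ ⟨k, rfl⟩
    simp only [image_singleton]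
    ext x
    simpa using (Subsingleton.elim _ _)
  chart_compat := by
    intro σ _ τ _
    exact ⟨fun _ => 0, ⟨0, 0, fun _ => Subsingleton.elim _ _⟩, fun _ _ => rfl⟩
  partition := by
    intro x
    have hu : (fun _ => 0 : Fin (N + 1) → (Fin 0 → ℝ)) '' {x} = univ := by
      ext y; simpa using (Subsingleton.elim _ _)
    refine ⟨{x}, ⟨⟨x, rfl⟩, rfl, ?_⟩, ?_⟩
    · change (0 : Fin 0 → ℝ) ∈ interior ((fun _ => 0 : Fin (N + 1) → (Fin 0 → ℝ)) '' {x})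
      rw [hu]; simp
    · rintro _ ⟨⟨k, rfl⟩, hk, -⟩
      obtain rfl : x = k := hk
      rfl
  pure := fun σ hσ => ⟨σ, hσ, subset_rfl, rfl⟩

theorem pointsPolyComplex_star (N : ℕ) (k : Fin (N + 1)) :
    (pointsPolyComplex N).star {k} = {k} := by
  ext x
  simp only [PolyComplex.star, mem_iUnion, mem_ofPred_eq, exists_prop]
  constructor
  · rintro ⟨_, ⟨⟨l, rfl⟩, hl⟩, hx, -⟩
    obtain rfl : x = l := hx
    obtain rfl : k = x := hl rfl
    rfl
  · rintro rfl
    obtain ⟨_, ⟨⟨l, rfl⟩, hx, h⟩, -⟩ := (pointsPolyComplex N).partition x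
    obtain rfl : x = l := hx
    exact ⟨_, ⟨⟨x, rfl⟩, subset_rfl⟩, rfl, h⟩

theorem pointFan_support : pointFan.support = univ := by
  simp [TropicalFan.support, pointFan]

/-- The points `{0, 1, …, N}` as a reduced tropical polyhedral complex of dimension `0`, with all
weights equal to `1`. -/
noncomputable def pointsComplex (N : ℕ) : TropicalComplex (Fin (N + 1)) 0 where
  toPolyComplex := pointsPolyComplex N
  weight := fun _ => 1
  weight_ne_zero := by simp
  amb := fun _ => 0
  fan := fun _ => pointFan
  nbhd := fun _ => univ
  isOpen_nbhd := by simp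
  zero_mem_nbhd := by simp
  fanChart := fun _ _ => 0
  fanChart_isEmbedding := by
    rintro _ ⟨k, rfl⟩
    dsimp only
    rw [pointsPolyComplex_star]
    exact .of_subsingleton _
  fanChart_image := by
    rintro _ ⟨k, rfl⟩
    dsimp only
    rw [pointsPolyComplex_star, pointFan_support]
    ext x
    simpa using (Subsingleton.elim _ _)
  fanChart_face := by
    rintro _ ⟨k, rfl⟩ _ ⟨l, rfl⟩ hkl
    dsimp only at hkl ⊢
    obtain rfl : k = l := hkl rfl
    refine ⟨univ, by simp [pointFan], ?_, fun _ => rfl⟩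
    rw [pointsPolyComplex_star, inter_self]
    ext x
    simpa using (Subsingleton.elim _ _)
  fanChart_of_chart := by
    intro σ _ τ _ _
    exact ⟨fun _ => 0, ⟨0, 0, fun _ => Subsingleton.elim _ _⟩, fun _ _ => rfl⟩
  chart_of_fanChart := by
    intro σ _ τ _ _
    have h : Subsingleton (Fin 0 → ℝ) := inferInstance
    exact ⟨fun _ => 0, ⟨0, 0, fun _ => h.elim _ _⟩, fun _ _ => h.elim _ _⟩
  fanChart_transition := by
    intro σ _ τ _
    exact ⟨fun _ => 0, ⟨0, 0, fun _ => Subsingleton.elim _ _⟩, fun _ _ => rfl⟩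

/-- The points `{0, 1, …, N}` as a tropical `0`-cycle, with all weights equal to `1`. -/
noncomputable def pointsCycle (N : ℕ) : TropicalCycle (Fin (N + 1)) 0 :=
  Quot.mk _ (pointsComplex N)

/-!
A tropical matrix `A` with at most one finite entry in each row has tropical rank equal to the
number of its *active* columns, those containing a finite entry: a non-vanishing minor uses active
columns only, and choosing a finite entry in each of `m` active columns gives `m` distinct rows,
hence a non-vanishing `m × m` minor (`exists_tropDet_ne_bot_iff`).

Active columns can be read off from the map `f_A`: column `j` is active if and only if `f_A` depends
on the `j`-th coordinate (`mem_activeCols_iff`). A change of trivialization of the source permutes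
the coordinates up to translation, and one of the target is injective on fibres, so the number of
active columns of a stalk matrix does not depend on the trivializations
(`TropicalBundleMorphism.IsStalkMatrix.card_activeCols_le`).

In fixed trivializations each entry is finite everywhere or nowhere, so the rank is locally
constant. Polyhedra are connected, so the rank is constant on each of them, and hence on its open
star; a locally constant map to finitely many points is therefore a morphism for every
representative of the source cycle.
-/

/-! ### The tropical rank of a row-monomial matrix -/

section TropicalRank

variable {r s : ℕ}

open Classical in
/-- The columns of `A` that contain a finite entry. -/
noncomputable def activeCols (A : TropMat r s) : Finset (Fin s) :=
  {j | ∃ i, A i j ≠ ⊥}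

theorem mem_activeCols {A : TropMat r s} {j : Fin s} : j ∈ activeCols A ↔ ∃ i, A i j ≠ ⊥ := by
  simp [activeCols]

theorem activeCols_congr {A A' : TropMat r s} (h : ∀ i j, A i j = ⊥ ↔ A' i j = ⊥) :
    activeCols A = activeCols A' := by
  ext j
  simp [mem_activeCols, h]

theorem card_activeCols_le_mul (A : TropMat r s) : (activeCols A).card ≤ s * r := by
  rcases Nat.eq_zero_or_pos r with rfl | hr
  · have : activeCols A = ∅ := by
      ext j
      simp [mem_activeCols]
    simp [this]
  · calc (activeCols A).card ≤ s := by simpa using (activeCols A).card_le_univ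
      _ ≤ s * r := Nat.le_mul_of_pos_right s hr

theorem tropDet_ne_bot_iff {k : ℕ} (A : TropMat k k) :
    tropDet A ≠ ⊥ ↔ ∃ σ : Equiv.Perm (Fin k), ∀ i, A i (σ i) ≠ ⊥ := by
  simp [tropDet, Finset.sup_eq_bot_iff, WithBot.sum_eq_bot_iff]

theorem exists_tropDet_ne_bot_iff {A : TropMat r s} (hA : IsRowMonomial A) (m : ℕ) :
    (∃ (I : Fin m ↪o Fin r) (J : Fin m ↪o Fin s), tropDet (A.submatrix I J) ≠ ⊥) ↔
      m ≤ (activeCols A).card := by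
  simp only [tropDet_ne_bot_iff, Matrix.submatrix_apply]
  constructor
  · rintro ⟨I, J, σ, h⟩
    have : Finset.univ.map J.toEmbedding ⊆ activeCols A := by
      intro j hj
      obtain ⟨k, -, rfl⟩ := Finset.mem_map.1 hj
      exact mem_activeCols.2 ⟨I (σ.symm k), by simpa using h (σ.symm k)⟩
    simpa using Finset.card_le_card this
  · intro hm
    obtain ⟨S, hS, hcard⟩ := Finset.exists_subset_card_eq hm
    have hrow : ∀ j : S, ∃ i, A i j ≠ ⊥ := fun j => mem_activeCols.1 (hS j.2)
    choose row hrow using hrow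
    have hinj : Function.Injective row := fun j j' hjj' =>
      Subtype.ext (hA (row j) j j' (hrow j) (hjj' ▸ hrow j'))
    obtain ⟨R, hR, hcardR⟩ : ∃ R : Finset (Fin r), (∀ i ∈ R, ∃ j, row j = i) ∧ R.card = m :=
      ⟨Finset.univ.map ⟨row, hinj⟩, fun i hi => by
        obtain ⟨j, -, hj⟩ := Finset.mem_map.1 hi
        exact ⟨j, hj⟩, by simpa using hcard⟩
    -- The chosen entries give a bijection from the selected rows to the selected columns.
    let I := R.orderIsoOfFin hcardR
    let J := S.orderIsoOfFin hcard
    have hI : ∀ k, ∃ j : S, row j = I k := fun k => hR _ (I k).2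
    choose col hcol using hI
    have hcolinj : Function.Injective col := fun k k' h =>
      I.injective (Subtype.ext (by rw [← hcol, ← hcol, h]))
    have hbij : Function.Bijective fun k => J.symm (col k) :=
      Finite.injective_iff_bijective.1 (J.symm.injective.comp hcolinj)
    refine ⟨R.orderEmbOfFin hcardR, S.orderEmbOfFin hcard,
      Equiv.ofBijective _ hbij, fun k => ?_⟩
    have h1 : R.orderEmbOfFin hcardR k = row (col k) := by
      rw [hcol, ← Finset.coe_orderIsoOfFin_apply]
    have h2 : S.orderEmbOfFin hcard (J.symm (col k)) = (col k : Fin s) := by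
      rw [← Finset.coe_orderIsoOfFin_apply]
      simp [J]
    rw [Equiv.ofBijective_apply, h1, h2]
    exact hrow (col k)

theorem isTropRank_iff {A : TropMat r s} (hA : IsRowMonomial A) {k : ℕ} :
    IsTropRank A k ↔ k = (activeCols A).card := by
  have h := exists_tropDet_ne_bot_iff hA (k + 1)
  rw [IsTropRank, exists_tropDet_ne_bot_iff hA k]
  constructor
  · rintro ⟨h1, h2⟩
    by_contra hne
    obtain ⟨I, J, hIJ⟩ := h.2 (by omega)
    exact hIJ (h1 I J)
  · rintro rfl
    refine ⟨fun I J => ?_, le_rfl⟩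
    by_contra hIJ
    have := h.1 ⟨I, J, hIJ⟩
    omega

end TropicalRank

/-! ### Dependence of `f_A` on the coordinates -/

section TropicalMap

variable {r s : ℕ}

theorem tropMap_congr {A : TropMat r s} {i : Fin r} {x y : Fin s → ℝ}
    (h : ∀ j, A i j ≠ ⊥ → x j = y j) : tropMap A x i = tropMap A y i := by
  unfold tropMap
  congr 2
  funext j
  by_cases hj : A i j = ⊥
  · simp [hj]
  · rw [h j hj]

theorem tropMap_apply_of_ne_bot {A : TropMat r s} (hA : IsRowMonomial A) {i : Fin r} {j : Fin s}
    (h : A i j ≠ ⊥) (x : Fin s → ℝ) : tropMap A x i = (A i j).unbotD 0 + x j := by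
  have hsup : (Finset.univ.sup fun k => A i k + (x k : TropNum)) = A i j + (x j : TropNum) := by
    refine le_antisymm (Finset.sup_le fun k _ => ?_)
      (Finset.le_sup (f := fun k => A i k + (x k : TropNum)) (Finset.mem_univ j))
    by_cases hk : A i k = ⊥
    · simp [hk]
    · rw [hA i j k h hk]
  obtain ⟨c, hc⟩ := WithBot.ne_bot_iff_exists.1 h
  rw [tropMap, hsup, ← hc, ← WithBot.coe_add, WithBot.unbotD_coe, WithBot.unbotD_coe]

theorem mem_activeCols_iff {A : TropMat r s} (hA : IsRowMonomial A) {j : Fin s} :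
    j ∈ activeCols A ↔
      ∃ x y : Fin s → ℝ, (∀ k, k ≠ j → x k = y k) ∧ tropMap A x ≠ tropMap A y := by
  rw [mem_activeCols]
  constructor
  · rintro ⟨i, hi⟩
    refine ⟨0, Pi.single j 1, fun k hk => by simp [hk], fun h => ?_⟩
    have := congrFun h i
    simp [tropMap_apply_of_ne_bot hA hi] at this
  · rintro ⟨x, y, hxy, hne⟩
    by_contra! hj
    refine hne (funext fun i => tropMap_congr fun k hk => hxy k ?_)
    rintro rfl
    exact hk (hj i)

/-- The map `f_Q` of a monomial matrix `Q` permutes the coordinates up to translation: changing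
only the `j`-th input changes only the `ν j`-th output. -/
theorem IsMonomial.exists_injective {Q : TropMat r r} (hQ : IsMonomial Q) :
    ∃ ν : Fin r → Fin r, Function.Injective ν ∧ ∀ j (x y : Fin r → ℝ),
      (∀ k, k ≠ j → x k = y k) → ∀ i, i ≠ ν j → tropMap Q x i = tropMap Q y i := by
  choose ν hν hν' using hQ.2
  refine ⟨ν, fun j j' h => (hQ.1 (ν j)).unique (hν j) (h ▸ hν j'), fun j x y hxy i hi => ?_⟩
  refine tropMap_congr fun k hk => hxy k ?_
  rintro rfl
  exact hi (hν' k i hk)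

end TropicalMap

/-! ### Stalk matrices in different trivializations -/

section Bundles

variable {B T T' : Type*} [TopologicalSpace B] [TopologicalSpace T] [TopologicalSpace T']
  {n e f : ℕ} {X : TropicalCycle B n} {CE : TropicalCycle T (n + e)} {CF : TropicalCycle T' (n + f)}
  {E : TropicalVectorBundle X e CE} {F : TropicalVectorBundle X f CF}

/-- Between any two local trivializations around `p`, the coordinates on the fibre over `p` are
permuted up to translation. The transition is factored through one of the given trivializations. -/
theorem TropicalVectorBundle.exists_transition
    {t t' : Bundle.Trivialization (Fin e → ℝ) E.proj} (ht : E.IsLocalTrivialization t)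
    (ht' : E.IsLocalTrivialization t') {p : B} (hp : p ∈ t.baseSet) (hp' : p ∈ t'.baseSet) :
    ∃ (g : (Fin e → ℝ) → Fin e → ℝ) (ν : Fin e → Fin e), Function.Injective ν ∧
      (∀ a, t.toOpenPartialHomeomorph.symm (p, a) = t'.toOpenPartialHomeomorph.symm (p, g a)) ∧
      ∀ j x y, (∀ k, k ≠ j → x k = y k) → ∀ i, i ≠ ν j → g x i = g y i := by
  obtain ⟨i, hi⟩ := E.cover p
  obtain ⟨M, hM, -⟩ := (ht.2 i).1
  obtain ⟨N, hN, -⟩ := (ht'.2 i).2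
  obtain ⟨hM, hMt⟩ := hM p ⟨hp, hi⟩
  obtain ⟨hN, hNt⟩ := hN p ⟨hi, hp'⟩
  obtain ⟨ν, hν, hν'⟩ := hM.exists_injective
  obtain ⟨μ, hμ, hμ'⟩ := hN.exists_injective
  have key : ∀ (t t' : Bundle.Trivialization (Fin e → ℝ) E.proj) (a b : Fin e → ℝ),
      p ∈ t.baseSet → p ∈ t'.baseSet → t' (t.toOpenPartialHomeomorph.symm (p, a)) = (p, b) →
      t.toOpenPartialHomeomorph.symm (p, a) = t'.toOpenPartialHomeomorph.symm (p, b) := by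
    intro t t' a b hp hp' h
    have hmem : t.toOpenPartialHomeomorph.symm (p, a) ∈ t'.source := by
      rw [t'.mem_source, t.proj_symm_apply' hp]
      exact hp'
    rw [← h]
    exact (t'.left_inv hmem).symm
  refine ⟨fun a => tropMap (N p) (tropMap (M p) a), μ ∘ ν, hμ.comp hν, fun a => ?_,
    fun j x y hxy => hμ' (ν j) _ _ (hν' j x y hxy)⟩
  rw [key _ _ _ _ hp hi (hMt a), key _ _ _ _ hi hp' (hNt _)]

theorem TropicalBundleMorphism.IsStalkMatrix.isRowMonomial {φ : TropicalBundleMorphism E F} {p : B}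
    {M : TropMat f e} (h : φ.IsStalkMatrix p M) : IsRowMonomial M := by
  obtain ⟨tE, tF, A, hp, hA, rfl⟩ := h
  exact hA.isRowMonomial p hp

theorem TropicalBundleMorphism.exists_isStalkMatrix (φ : TropicalBundleMorphism E F) (p : B) :
    ∃ M, φ.IsStalkMatrix p M := by
  obtain ⟨s, tE, tF, A, hcov, hA⟩ := φ.exists_local
  obtain ⟨i, hi⟩ := hcov p
  exact ⟨A i p, tE i, tF i, A i, hi, hA i, rfl⟩

/-- A coordinate on which `φ_p` depends corresponds to such a coordinate in any other
trivialization; by symmetry the numbers of active columns agree. -/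
theorem TropicalBundleMorphism.IsStalkMatrix.card_activeCols_le
    {φ : TropicalBundleMorphism E F} {p : B} {M M' : TropMat f e}
    (h : φ.IsStalkMatrix p M) (h' : φ.IsStalkMatrix p M') :
    (activeCols M).card ≤ (activeCols M').card := by
  have hM := h.isRowMonomial
  have hM' := h'.isRowMonomial
  obtain ⟨tE, tF, A, hp, hA, rfl⟩ := h
  obtain ⟨tE', tF', A', hp', hA', rfl⟩ := h'
  obtain ⟨g, ν, hν, hg, hgν⟩ := E.exists_transition hA.left hA'.left hp hp'
  refine Finset.card_le_card_of_injOn ν (fun j hj => ?_) hν.injOn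
  obtain ⟨x, y, hxy, hne⟩ := (mem_activeCols_iff hM).1 hj
  refine (mem_activeCols_iff hM').2 ⟨g x, g y, hgν j x y hxy, fun heq => hne ?_⟩
  have hx := hA'.map_eq p hp' (g x)
  have hy := hA'.map_eq p hp' (g y)
  rw [← hg] at hx hy
  have hsource : ∀ a,
      φ.toFun (tE.toOpenPartialHomeomorph.symm (p, a)) ∈ tF'.source := fun a => by
    rw [tF'.mem_source, φ.proj_comp, tE.proj_symm_apply' hp, ← hA'.baseSet_eq]
    exact hp'
  have hφ := tF'.injOn (hsource x) (hsource y) (hx.trans (heq ▸ hy.symm))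
  have hmap := hA.map_eq p hp x
  rw [hφ, hA.map_eq p hp y] at hmap
  exact (Prod.ext_iff.1 hmap).2.symm

theorem IsLocalMatrix.activeCols_eq {φ : T → T'} {tE : Bundle.Trivialization (Fin e → ℝ) E.proj}
    {tF : Bundle.Trivialization (Fin f → ℝ) F.proj} {A : B → TropMat f e}
    (hA : IsLocalMatrix E F φ tE tF A) {p q : B} (hp : p ∈ tE.baseSet) (hq : q ∈ tE.baseSet) :
    activeCols (A p) = activeCols (A q) := by
  refine activeCols_congr fun i j => ?_
  rcases hA.regular i j with h | ⟨h, -, hh⟩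
  · simp [h p hp, h q hq]
  · simp [hh p hp, hh q hq]

end Bundles

/-! ### Locally constant functions as morphisms -/

section LocallyConstant

variable {T : Type*} [TopologicalSpace T] {n : ℕ}

theorem IsRationalPolyhedron.convex {N : ℕ} {P : Set (Fin N → ℝ)} (hP : IsRationalPolyhedron P) :
    Convex ℝ P := by
  obtain ⟨k, a, c, rfl⟩ := hP
  rw [ofPred_forall]
  refine convex_iInter fun i => convex_halfSpace_ge (f := fun x : Fin N → ℝ => ∑ j, (a i j : ℝ) * x j) ?_ (c i)
  constructor
  · intro x y
    simp [mul_add, Finset.sum_add_distrib]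
  · intro t x
    simp only [Pi.smul_apply, smul_eq_mul, Finset.mul_sum]
    exact Finset.sum_congr rfl fun j _ => by ring

theorem PolyComplex.isPreconnected_of_mem (X : PolyComplex T n) {σ : Set T} (hσ : σ ∈ X.faces) :
    IsPreconnected σ := by
  have h := (X.chart_isPolyhedron σ hσ).convex.isPreconnected
  rw [← range_domRestrict, ← image_univ,
    (X.chart_isEmbedding σ hσ).isInducing.isPreconnected_image] at h
  simpa using h.image Subtype.val continuous_subtype_val.continuousOn

theorem IsLocallyConstant.isMorphism_pointsCycle {N : ℕ} {g : T → Fin (N + 1)}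
    (hg : IsLocallyConstant g) (C : TropicalCycle T n) : C.IsMorphism (pointsCycle N) g := by
  obtain ⟨X, hX⟩ := Quot.exists_rep C
  refine ⟨hg.continuous, X, pointsComplex N, hX, rfl, fun σ hσ => ?_⟩
  obtain ⟨x, hx⟩ := X.nonempty_of_mem σ hσ
  have hconst : ∀ τ ∈ X.faces, σ ⊆ τ → ∀ y ∈ τ, g y = g x := fun τ hτ hστ y hy =>
    hg.apply_eq_of_isPreconnected (X.isPreconnected_of_mem hτ) hy (hστ hx)
  -- All points of the target have ambient space `ℝ^0`, so the conditions on charts are vacuous.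
  refine ⟨{g x}, ⟨g x, rfl⟩, ?_, ?_, 0, 0, fun _ _ => ?_, fun _ _ => ?_⟩
  · rintro _ ⟨y, hy, rfl⟩
    exact hconst σ hσ subset_rfl y hy
  · rintro _ ⟨y, hy, rfl⟩
    simp only [PolyComplex.star, mem_iUnion, exists_prop] at hy
    obtain ⟨τ, ⟨hτ, hστ⟩, hyτ⟩ := hy
    exact (pointsPolyComplex_star N (g x)).symm ▸ hconst τ hτ hστ y hyτ.1
  · exact Subsingleton.elim (α := Fin 0 → ℝ) _ _
  · exact pointFan_support.symm ▸ mem_univ _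

end LocallyConstant

theorem mainTheorem10 {B T T' : Type*} [TopologicalSpace B] [TopologicalSpace T]
    [TopologicalSpace T'] {n e f : ℕ} {X : TropicalCycle B n} {CE : TropicalCycle T (n + e)}
    {CF : TropicalCycle T' (n + f)} (E : TropicalVectorBundle X e CE)
    (F : TropicalVectorBundle X f CF) (φ : TropicalBundleMorphism E F) :
    (∃! ρ : B → ℕ, ∀ p M, φ.IsStalkMatrix p M → IsTropRank M (ρ p)) ∧
    ∀ ρ : B → ℕ, (∀ p M, φ.IsStalkMatrix p M → IsTropRank M (ρ p)) →
      IsLocallyConstant ρ ∧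
      ∃ hρ : ∀ p, ρ p < e * f + 1,
        X.IsMorphism (pointsCycle (e * f)) fun p => (⟨ρ p, hρ p⟩ : Fin (e * f + 1)) := by
  have hrank : ∀ {p M M'} {k : ℕ}, φ.IsStalkMatrix p M → φ.IsStalkMatrix p M' →
      (IsTropRank M k ↔ k = (activeCols M').card) := fun {p M M' k} h h' => by
    rw [isTropRank_iff h.isRowMonomial,
      le_antisymm (h.card_activeCols_le h') (h'.card_activeCols_le h)]
  choose M hM using φ.exists_isStalkMatrix
  refine ⟨⟨fun p => (activeCols (M p)).card, fun p M' h => (hrank h (hM p)).2 rfl,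
    fun ρ hρ => funext fun p => (hrank (hM p) (hM p)).1 (hρ p _ (hM p))⟩, fun ρ hρ => ?_⟩
  have hρM : ∀ {p M'}, φ.IsStalkMatrix p M' → ρ p = (activeCols M').card := fun {p M'} h =>
    (hrank h h).1 (hρ p M' h)
  have hloc : IsLocallyConstant ρ := by
    refine (IsLocallyConstant.iff_exists_open ρ).2 fun p => ?_
    obtain ⟨tE, tF, A, hp, hA, -⟩ := hM p
    refine ⟨tE.baseSet, tE.open_baseSet, hp, fun q hq => ?_⟩
    rw [hρM ⟨tE, tF, A, hq, hA, rfl⟩, hρM ⟨tE, tF, A, hp, hA, rfl⟩, hA.activeCols_eq hq hp]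
  have hlt : ∀ p, ρ p < e * f + 1 := fun p => by
    rw [hρM (hM p)]
    exact Nat.lt_succ_of_le (card_activeCols_le_mul (M p))
  refine ⟨hloc, hlt, IsLocallyConstant.isMorphism_pointsCycle ?_ X⟩
  exact (IsLocallyConstant.iff_exists_open _).2 fun p => by
    obtain ⟨U, hU, hp, h⟩ := hloc.exists_open p
    exact ⟨U, hU, hp, fun q hq => Fin.ext (h q hq)⟩
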